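/- Setting. Let $\mathcal D$ be a measurable space of datasets and $R$ an arbitrary relation on $\mathcal D$; $D_1,D_2$ are called neighbouring if $R(D_1,D_2)$. A mechanism $\mathcal M$ with outputs in a measurable space $\mathcal O$ is a Markov kernel $D\mapsto\mathcal M(D)$ from $\mathcal D$ to $\mathcal O$ (if $\mathcal D$ carries the discrete $\sigma$-algebra: any family of probability distributions on $\mathcal O$). A privacy definition is a property of mechanisms. It satisfies the *post-processing axiom* if, whenever $\mathcal M$ satisfies it and $g$ is a probabilistic function (a Markov kernel from $\mathcal O$ to a measurable space $\mathcal O'$), the mechanism $D\mapsto g(\mathcal M(D))$ satisfies it; it satisfies the *convexity axiom* if, whenever $\mathcal M_1,\mathcal M_2$ (with the same output space) satisfy it and $p\in[0,1]$, the mechanism $D\mapsto p\,\mathcal M_1(D)+(1-p)\,\mathcal M_2(D)$ satisfies it. For convex $f:(0,\infty)\to\mathbb R$ with $f(1)=0$ put $f(0)=\lim_{t\to0^+}f(t)$ and $f'(\infty)=\lim_{t\to\infty}f(t)/t$, both in $(-\infty,\infty]$. For probability measures $P,Q$ let $D_f(P\|Q)=\int f\!\left(\tfrac{dP}{dQ}\right)dQ+f'(\infty)\,P_s(\mathcal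 O)$, where $\tfrac{dP}{dQ}$ is the density of the $Q$-absolutely continuous part of $P$, $P_s$ is the $Q$-singular part of $P$, and $\infty\cdot0=0$. A mechanism is $(f,\varepsilon)$-*divergence DP* if $D_f(\mathcal M(D_1)\|\mathcal M(D_2))\le\varepsilon$ for all neighbouring $D_1,D_2$. Theorem. For every convex $f:(0,\infty)\to\mathbb R$ with $f(1)=0$ and every $\varepsilon\in\mathbb R$, $(f,\varepsilon)$-divergence DP satisfies both privacy axioms. Moreover, each of the following privacy definitions satisfies both axioms, for all real values of its parameters (in (1), (3), (4), (5) the condition is required for all neighbouring $D_1,D_2$; in (4), (5), $L(O)=\ln\frac{p(O)}{q(O)}$ with $p,q$ the densities of $\mathcal M(D_1),\mathcal M(D_2)$ with respect to their sum, $L=\infty$ where only $q=0$, and $L=-\infty$ where $p=0$): 1. $(\varepsilon,\delta)$-approximate DP: $\Pr[\mathcal M(D_1)\in S]\le e^{\varepsilon}\Pr[\mathcal M(D_2)\in S]+\delta$ for all measurable $S$. 2. $\varepsilon$-mutual-information privacy, for datasets that are finite sequences of records from a nonempty standard Borel space $\mathcal T$: for every $n\ge1$, every $i\le n$ and every probability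 distribution $\theta$ on $\mathcal T^n$, if $D\sim\theta$ then $I\big(D(i);\mathcal M(D)\,\big|\,D_{-i}\big)\le\varepsilon$, where $D(i)$ is the $i$-th record and $D_{-i}$ the sequence of the other records. 3. $\varepsilon$-KL privacy: $D_{\mathrm{KL}}(\mathcal M(D_1)\|\mathcal M(D_2))\le\varepsilon$. 4. $(\alpha,\varepsilon)$-Rényi DP, $\alpha>1$: $\mathbb E_{O\sim\mathcal M(D_1)}\big[e^{(\alpha-1)L(O)}\big]\le e^{(\alpha-1)\varepsilon}$. 5. $(\xi,\rho)$-zero-concentrated DP: $\mathbb E_{O\sim\mathcal M(D_1)}\big[e^{(\alpha-1)L(O)}\big]\le e^{(\alpha-1)(\xi+\rho\alpha)}$ for all $\alpha>1$. -/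

import Mathlib

open MeasureTheory ProbabilityTheory Filter Topology InformationTheory
open scoped ENNReal

universe u v w

noncomputable section

/-! ### Privacy definitions and the two privacy axioms -/

/-- A privacy definition for mechanisms with inputs in `𝒟`: a property of mechanisms, for
mechanisms with any measurable space `O` of outputs. A mechanism is a Markov kernel from the datasets
to the outputs (with the σ-algebra `⊤` on `𝒟`, an arbitrary family of output distributions). -/
def PrivacyDefinition (𝒟 : Type u) [MeasurableSpace 𝒟] : Type (max u (v + 1)) :=
  ∀ (O : Type v) [MeasurableSpace O], Kernel 𝒟 O → Prop

/-- The mechanism that runs `M₁` with probability `p` and `M₂` with probability `1 - p`. -/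
def mixKernel {𝒟 : Type u} [MeasurableSpace 𝒟] {O : Type v} [MeasurableSpace O]
    (p : unitInterval) (M₁ M₂ : Kernel 𝒟 O) : Kernel 𝒟 O where
  toFun D := ENNReal.ofReal (p : ℝ) • M₁ D + ENNReal.ofReal (1 - (p : ℝ)) • M₂ D
  measurable' := by
    refine Measure.measurable_of_measurable_coe _ fun s hs => ?_
    simp only [Measure.coe_add, Measure.coe_smul, Pi.add_apply, Pi.smul_apply, smul_eq_mul]
    exact ((M₁.measurable_coe hs).const_mul _).add ((M₂.measurable_coe hs).const_mul _)

/-- Post-processing: applying a probabilistic function `g` (a Markov kernel) to the output of a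
mechanism that satisfies the definition gives a mechanism that satisfies it. -/
def SatisfiesPostProcessing {𝒟 : Type u} [MeasurableSpace 𝒟]
    (Def : PrivacyDefinition.{u, v} 𝒟) : Prop :=
  ∀ (O O' : Type v) [MeasurableSpace O] [MeasurableSpace O']
    (M : Kernel 𝒟 O) [IsMarkovKernel M] (g : Kernel O O') [IsMarkovKernel g],
    Def O M → Def O' (g ∘ₖ M)

/-- Convexity (privacy axiom of choice). -/
def SatisfiesConvexity {𝒟 : Type u} [MeasurableSpace 𝒟]
    (Def : PrivacyDefinition.{u, v} 𝒟) : Prop :=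
  ∀ (O : Type v) [MeasurableSpace O]
    (M₁ M₂ : Kernel 𝒟 O) [IsMarkovKernel M₁] [IsMarkovKernel M₂] (p : unitInterval),
    Def O M₁ → Def O M₂ → Def O (mixKernel p M₁ M₂)

/-- Both privacy axioms. -/
def SatisfiesPrivacyAxioms {𝒟 : Type u} [MeasurableSpace 𝒟]
    (Def : PrivacyDefinition.{u, v} 𝒟) : Prop :=
  SatisfiesPostProcessing Def ∧ SatisfiesConvexity Def

/-! ### `f`-divergences and divergence DP -/

/-- `f(0+) = lim_{t → 0+} f t`, in `(-∞, ∞]` for convex `f` (the limit exists then, and the upper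
limit is equal to it). -/
def fAtZero (f : ℝ → ℝ) : EReal := limsup (fun t : ℝ => (f t : EReal)) (𝓝[>] 0)

/-- `f'(∞) = lim_{t → ∞} f t / t`, in `(-∞, ∞]` for convex `f`. -/
def fSlopeAtTop (f : ℝ → ℝ) : EReal := limsup (fun t : ℝ => ((f t / t : ℝ) : EReal)) atTop

/-- `f` evaluated at a density ratio, with `f(0) := f(0+)`. -/
def fAtRatio (f : ℝ → ℝ) (r : ℝ≥0∞) : EReal :=
  if r = 0 then fAtZero f else (f r.toReal : EReal)

/-- The `f`-divergence `D_f(P ‖ Q) = ∫ f(dP/dQ) dQ + f'(∞) · P_s(Ω)`, where `P_s` is the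
`Q`-singular part of `P`. The integral of the extended-real function is the integral of its positive
part minus that of its negative part; the latter is finite for convex `f` and probability measures. -/
def fDivergence {O : Type v} [MeasurableSpace O] (f : ℝ → ℝ) (P Q : Measure O) : EReal :=
  (((∫⁻ x, (fAtRatio f (P.rnDeriv Q x)).toENNReal ∂Q : ℝ≥0∞) : EReal)
      - ((∫⁻ x, (-fAtRatio f (P.rnDeriv Q x)).toENNReal ∂Q : ℝ≥0∞) : EReal))
    + fSlopeAtTop f * ((P.singularPart Q Set.univ : ℝ≥0∞) : EReal)

/-- `(f, ε)`-divergence DP for the neighbouring relation `R`. -/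
def DivDP {𝒟 : Type u} [MeasurableSpace 𝒟] (R : 𝒟 → 𝒟 → Prop) (f : ℝ → ℝ) (ε : ℝ) :
    PrivacyDefinition.{u, v} 𝒟 :=
  fun _ _ M => ∀ D₁ D₂, R D₁ D₂ → fDivergence f (M D₁) (M D₂) ≤ (ε : EReal)

/-! ### The other privacy definitions -/

/-- `(ε, δ)`-approximate DP. -/
def ApproxDP {𝒟 : Type u} [MeasurableSpace 𝒟] (R : 𝒟 → 𝒟 → Prop) (ε δ : ℝ) :
    PrivacyDefinition.{u, v} 𝒟 :=
  fun O _ M => ∀ D₁ D₂, R D₁ D₂ → ∀ S : Set O, MeasurableSet S →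
    (M D₁).real S ≤ Real.exp ε * (M D₂).real S + δ

/-- `ε`-Kullback-Leibler privacy. -/
def KLPrivacy {𝒟 : Type u} [MeasurableSpace 𝒟] (R : 𝒟 → 𝒟 → Prop) (ε : ℝ) :
    PrivacyDefinition.{u, v} 𝒟 :=
  fun _ _ M => ∀ D₁ D₂, R D₁ D₂ → ((klDiv (M D₁) (M D₂) : ℝ≥0∞) : EReal) ≤ (ε : EReal)

/-- The privacy loss `ln (p/q)`, where `p` and `q` are the densities of `P` and `Q` with respect to
`P + Q`: it is `∞` where only `q` vanishes and `-∞` where `p` vanishes. -/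
def privacyLoss {O : Type v} [MeasurableSpace O] (P Q : Measure O) (x : O) : EReal :=
  ENNReal.log (P.rnDeriv (P + Q) x / Q.rnDeriv (P + Q) x)

/-- `(α, ε)`-Rényi DP (for `α > 1`): `E_{O ∼ M(D₁)} [exp ((α - 1) L(O))] ≤ exp ((α - 1) ε)`. -/
def RenyiDP {𝒟 : Type u} [MeasurableSpace 𝒟] (R : 𝒟 → 𝒟 → Prop) (α ε : ℝ) :
    PrivacyDefinition.{u, v} 𝒟 :=
  fun _ _ M => ∀ D₁ D₂, R D₁ D₂ →
    ∫⁻ x, EReal.exp (((α - 1 : ℝ) : EReal) * privacyLoss (M D₁) (M D₂) x) ∂(M D₁)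
      ≤ ENNReal.ofReal (Real.exp ((α - 1) * ε))

/-- `(ξ, ρ)`-zero-concentrated DP. -/
def ZeroConcentratedDP {𝒟 : Type u} [MeasurableSpace 𝒟] (R : 𝒟 → 𝒟 → Prop) (ξ ρ : ℝ) :
    PrivacyDefinition.{u, v} 𝒟 :=
  fun _ _ M => ∀ D₁ D₂, R D₁ D₂ → ∀ α : ℝ, 1 < α →
    ∫⁻ x, EReal.exp (((α - 1 : ℝ) : EReal) * privacyLoss (M D₁) (M D₂) x) ∂(M D₁)
      ≤ ENNReal.ofReal (Real.exp ((α - 1) * (ξ + ρ * α)))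

/-! ### Mutual-information privacy -/

/-- Finite sequences of records. -/
abbrev Dataset (T : Type w) : Type w := Σ n : ℕ, (Fin n → T)

/-- The dataset whose `i`-th record is `p.2` and whose remaining records are `p.1`. -/
def insertRecord {T : Type w} {n : ℕ} (i : Fin (n + 1)) (p : (Fin n → T) × T) : Dataset T :=
  ⟨n + 1, i.insertNth p.2 p.1⟩

theorem measurable_dataset_mk {T : Type w} [MeasurableSpace T] (n : ℕ) :
    Measurable (fun D : Fin n → T => (⟨n, D⟩ : Dataset T)) :=
  fun _ hs => (MeasurableSpace.measurableSet_iInf.1 hs) n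

theorem measurable_insertRecord {T : Type w} [MeasurableSpace T] {n : ℕ} (i : Fin (n + 1)) :
    Measurable (insertRecord i : (Fin n → T) × T → Dataset T) :=
  (measurable_dataset_mk (n + 1)).comp
    ((MeasurableEquiv.piFinSuccAbove (fun _ => T) i).symm.measurable.comp measurable_swap)

/-- The mechanism restricted to datasets of size `n`. -/
def mechOnSize {T : Type w} [MeasurableSpace T] {O : Type v} [MeasurableSpace O]
    (M : Kernel (Dataset T) O) (n : ℕ) : Kernel (Fin n → T) O :=
  M.comap (fun D => (⟨n, D⟩ : Dataset T)) (measurable_dataset_mk n)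

/-- The conditional distribution of the record `D(i)` given `D_{-i}`, for `D ∼ θ`. -/
def recordGivenRest {T : Type w} [MeasurableSpace T] [StandardBorelSpace T] [Nonempty T] {n : ℕ}
    (θ : Measure (Fin (n + 1) → T)) [IsProbabilityMeasure θ] (i : Fin (n + 1)) :
    Kernel (Fin n → T) T :=
  condDistrib (fun D : Fin (n + 1) → T => D i) (fun D => i.removeNth D) θ

/-- The conditional distribution of `M(D)` given `D_{-i}`, for `D ∼ θ`: draw `D(i)` from its
conditional distribution, then run `M`. -/
def outputGivenRest {T : Type w} [MeasurableSpace T] [StandardBorelSpace T] [Nonempty T]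
    {O : Type v} [MeasurableSpace O] (M : Kernel (Dataset T) O) {n : ℕ}
    (θ : Measure (Fin (n + 1) → T)) [IsProbabilityMeasure θ] (i : Fin (n + 1)) :
    Kernel (Fin n → T) O :=
  (M.comap (insertRecord i) (measurable_insertRecord i)) ∘ₖ (Kernel.id ×ₖ recordGivenRest θ i)

/-- The conditional mutual information `I(D(i) ; M(D) | D_{-i})` for `D ∼ θ`: the Kullback-Leibler
divergence of the joint law of `(D_{-i}, D(i), M(D))` from the law with the same conditional
marginals under which `D(i)` and `M(D)` are conditionally independent given `D_{-i}`. -/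
def recordMutualInfo {T : Type w} [MeasurableSpace T] [StandardBorelSpace T] [Nonempty T]
    {O : Type v} [MeasurableSpace O] (M : Kernel (Dataset T) O) {n : ℕ}
    (θ : Measure (Fin (n + 1) → T)) [IsProbabilityMeasure θ] (i : Fin (n + 1)) : ℝ≥0∞ :=
  klDiv
    ((θ ⊗ₘ mechOnSize M (n + 1)).map
      (fun q : (Fin (n + 1) → T) × O => (i.removeNth q.1, q.1 i, q.2)))
    ((θ.map (fun D => i.removeNth D)) ⊗ₘ (recordGivenRest θ i ×ₖ outputGivenRest M θ i))

/-- `ε`-mutual-information privacy: the bound holds for every size, every record and every prior. -/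
def MIPrivacy (T : Type w) [MeasurableSpace T] [StandardBorelSpace T] [Nonempty T] (ε : ℝ) :
    PrivacyDefinition.{w, v} (Dataset T) :=
  fun _ _ M => ∀ (n : ℕ) (θ : Measure (Fin (n + 1) → T)) [IsProbabilityMeasure θ]
    (i : Fin (n + 1)), ((recordMutualInfo M θ i : ℝ≥0∞) : EReal) ≤ (ε : EReal)

end

/-
For convex `f ≥ 0`, the divergence `D_f(P ‖ Q)` is the mass of the least measure that dominates
`a P + b Q` for every affine minorant `a t + b` of `f`. Domination is a linear condition, so it
survives Markov kernels and mixtures; this gives the data processing inequality and joint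
convexity. A general convex `f` differs from a nonnegative one by an affine function, which
contributes only `a P(Ω) + b Q(Ω)`, invariant under kernels and linear under mixing.

KL and Rényi privacy are bounds on `D_f` for `f(t) = t log t + 1 - t` and `f(t) = t ^ α`.
Approximate DP says that `P` is dominated by `e ^ ε Q` plus a measure of mass at most `δ`, again a
linear condition. The conditional mutual information is the KL divergence between the joint law of
the split dataset and the output, and the law in which the output kernel is averaged over the
distinguished record; both laws depend linearly on the output kernel.
-/

/-- The affine function `t ↦ a * t + b` lies below `f` on the positive half-line. -/
def IsAffineMinorant (f : ℝ → ℝ) (a b : ℝ) : Prop :=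
  ∀ t : ℝ, 0 < t → a * t + b ≤ f t

section AffineMinorants

variable {f : ℝ → ℝ} {a b : ℝ}

theorem IsAffineMinorant.le_fAtZero (h : IsAffineMinorant f a b) : (b : EReal) ≤ fAtZero f := by
  have hlim : Tendsto (fun t : ℝ => ((a * t + b : ℝ) : EReal)) (𝓝[>] 0) (𝓝 b) := by
    refine (continuous_coe_real_ereal.tendsto b).comp ?_
    exact (Continuous.tendsto' (by fun_prop) 0 _ (by simp)).mono_left nhdsWithin_le_nhds
  rw [← hlim.limsup_eq]
  refine limsup_le_limsup ?_
  filter_upwards [self_mem_nhdsWithin] with t ht using EReal.coe_le_coe_iff.2 (h t ht)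

theorem IsAffineMinorant.le_fSlopeAtTop (h : IsAffineMinorant f a b) :
    (a : EReal) ≤ fSlopeAtTop f := by
  have hlim : Tendsto (fun t : ℝ => ((a + b / t : ℝ) : EReal)) atTop (𝓝 a) := by
    refine (continuous_coe_real_ereal.tendsto a).comp ?_
    simpa using (tendsto_const_nhds (x := b)).div_atTop tendsto_id |>.const_add a
  rw [← hlim.limsup_eq]
  refine limsup_le_limsup ?_
  filter_upwards [eventually_gt_atTop 0] with t ht
  rw [EReal.coe_le_coe_iff, le_div_iff₀ ht, add_mul, div_mul_cancel₀ _ ht.ne']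
  exact h t ht

theorem IsAffineMinorant.le_fAtRatio (h : IsAffineMinorant f a b) {r : ℝ≥0∞} (hr : r ≠ ∞) :
    ((a * r.toReal + b : ℝ) : EReal) ≤ fAtRatio f r := by
  rcases eq_or_ne r 0 with rfl | h0
  · simpa [fAtRatio] using h.le_fAtZero
  · simpa only [fAtRatio, if_neg h0] using
      EReal.coe_le_coe_iff.2 (h r.toReal (ENNReal.toReal_pos h0 hr))

theorem exists_isAffineMinorant_eq (hf : ConvexOn ℝ (Set.Ioi 0) f) {s : ℝ} (hs : 0 < s) :
    ∃ a b, IsAffineMinorant f a b ∧ a * s + b = f s := by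
  have hint : s ∈ interior (Set.Ioi (0 : ℝ)) := by simpa using hs
  let a := derivWithin f (Set.Ioi s) s
  refine ⟨a, f s - a * s, fun t ht => ?_, by ring⟩
  rcases lt_trichotomy t s with h | rfl | h
  · have hslope := (hf.slope_le_leftDeriv_of_mem_interior ht hint h).trans
      (hf.leftDeriv_le_rightDeriv_of_mem_interior hint)
    rw [slope_def_field, div_le_iff₀ (by linarith)] at hslope
    linarith
  · linarith
  · have hslope := hf.rightDeriv_le_slope_of_mem_interior hint ht h
    rw [slope_def_field, le_div_iff₀ (by linarith)] at hslope
    linarith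

theorem fAtZero_le_of_forall_isAffineMinorant (hf : ConvexOn ℝ (Set.Ioi 0) f) {y : EReal}
    (h : ∀ a b, IsAffineMinorant f a b → (b : EReal) ≤ y) : fAtZero f ≤ y := by
  obtain ⟨a₁, b₁, hmin₁, heq₁⟩ := exists_isAffineMinorant_eq hf one_pos
  induction y with
  | bot => exact absurd (h a₁ b₁ hmin₁) (by simp)
  | top => exact le_top
  | coe y =>
    have hlim : Tendsto (fun t : ℝ => ((y + a₁ * t : ℝ) : EReal)) (𝓝[>] 0) (𝓝 y) := by
      refine (continuous_coe_real_ereal.tendsto y).comp ?_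
      exact (Continuous.tendsto' (by fun_prop) 0 _ (by simp)).mono_left nhdsWithin_le_nhds
    rw [← hlim.limsup_eq]
    refine limsup_le_limsup ?_
    filter_upwards [Ioo_mem_nhdsGT one_pos] with t ⟨ht0, ht1⟩
    obtain ⟨a, b, hmin, heq⟩ := exists_isAffineMinorant_eq hf ht0
    have hb : b ≤ y := EReal.coe_le_coe_iff.1 (h a b hmin)
    have ha : a ≤ a₁ := by
      refine le_of_mul_le_mul_right ?_ (sub_pos.2 ht1)
      linarith [hmin 1 one_pos, hmin₁ t ht0]
    rw [EReal.coe_le_coe_iff]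
    linarith [mul_le_mul_of_nonneg_right ha ht0.le]

theorem fSlopeAtTop_le_of_forall_isAffineMinorant (hf : ConvexOn ℝ (Set.Ioi 0) f) {y : EReal}
    (h : ∀ a b, IsAffineMinorant f a b → (a : EReal) ≤ y) : fSlopeAtTop f ≤ y := by
  induction y with
  | bot =>
    obtain ⟨a, b, hmin, -⟩ := exists_isAffineMinorant_eq hf one_pos
    exact absurd (h a b hmin) (by simp)
  | top => exact le_top
  | coe y =>
    have hlim : Tendsto (fun t : ℝ => ((y + (f 1 - y) / t : ℝ) : EReal)) atTop (𝓝 y) := by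
      refine (continuous_coe_real_ereal.tendsto y).comp ?_
      simpa using (tendsto_const_nhds (x := f 1 - y)).div_atTop tendsto_id |>.const_add y
    rw [← hlim.limsup_eq]
    refine limsup_le_limsup ?_
    filter_upwards [eventually_gt_atTop 1] with t ht
    have ht0 : 0 < t := one_pos.trans ht
    obtain ⟨a, b, hmin, heq⟩ := exists_isAffineMinorant_eq hf ht0
    have ha : a ≤ y := EReal.coe_le_coe_iff.1 (h a b hmin)
    rw [EReal.coe_le_coe_iff, div_le_iff₀ ht0, add_mul, div_mul_cancel₀ _ ht0.ne']
    linarith [hmin 1 one_pos, mul_le_mul_of_nonneg_right ha (sub_pos.2 ht).le]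

theorem fAtRatio_le_of_forall_isAffineMinorant (hf : ConvexOn ℝ (Set.Ioi 0) f) {r : ℝ≥0∞}
    (hr : r ≠ ∞) {y : EReal}
    (h : ∀ a b, IsAffineMinorant f a b → ((a * r.toReal + b : ℝ) : EReal) ≤ y) :
    fAtRatio f r ≤ y := by
  rcases eq_or_ne r 0 with rfl | h0
  · simpa [fAtRatio] using fAtZero_le_of_forall_isAffineMinorant hf (by simpa using h)
  · obtain ⟨a, b, hmin, heq⟩ := exists_isAffineMinorant_eq hf (ENNReal.toReal_pos h0 hr)
    simpa [fAtRatio, h0, heq] using h a b hmin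

theorem measurable_fAtRatio (hf : ConvexOn ℝ (Set.Ioi 0) f) : Measurable (fAtRatio f) := by
  classical
  have hpiece : Measurable ((Set.Ioi (0 : ℝ)).piecewise f fun _ => f 0) :=
    (hf.continuousOn isOpen_Ioi).measurable_piecewise continuousOn_const measurableSet_Ioi
  have heq (r : ℝ≥0∞) :
      (Set.Ioi (0 : ℝ)).piecewise f (fun _ => f 0) r.toReal = f r.toReal := by
    rcases (ENNReal.toReal_nonneg (a := r)).eq_or_lt with h | h
    · simp [← h]
    · exact Set.piecewise_eq_of_mem _ _ _ h
  have hcomp : Measurable fun r : ℝ≥0∞ => f r.toReal :=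
    (funext heq : _ = fun r : ℝ≥0∞ => f r.toReal) ▸ hpiece.comp ENNReal.measurable_toReal
  exact Measurable.ite (measurableSet_singleton 0) measurable_const hcomp.coe_real_ereal

end AffineMinorants

section Normalization

variable {f : ℝ → ℝ}

theorem limsup_coe_add_of_tendsto {α : Type*} {l : Filter α} [l.NeBot] {u v : α → ℝ} {c : ℝ}
    (hv : Tendsto v l (𝓝 c)) :
    limsup (fun x => ((u x + v x : ℝ) : EReal)) l = limsup (fun x => (u x : EReal)) l + c := by
  have hv' : Tendsto (fun x => (v x : EReal)) l (𝓝 c) :=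
    (continuous_coe_real_ereal.tendsto c).comp hv
  have hadd : (fun x => ((u x + v x : ℝ) : EReal)) =
      (fun x => (u x : EReal)) + fun x => (v x : EReal) := rfl
  rw [hadd]
  refine le_antisymm ?_ ?_
  · rw [← hv'.limsup_eq]
    apply EReal.limsup_add_le <;> simp [hv'.limsup_eq]
  · rw [← hv'.liminf_eq]
    exact EReal.le_limsup_add

theorem fAtZero_add_affine (f : ℝ → ℝ) (a b : ℝ) :
    fAtZero (fun t => f t + (a * t + b)) = fAtZero f + b := by
  refine limsup_coe_add_of_tendsto ?_
  exact (Continuous.tendsto' (by fun_prop) 0 _ (by simp)).mono_left nhdsWithin_le_nhds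

theorem fSlopeAtTop_add_affine (f : ℝ → ℝ) (a b : ℝ) :
    fSlopeAtTop (fun t => f t + (a * t + b)) = fSlopeAtTop f + a := by
  simp only [fSlopeAtTop, add_div]
  refine limsup_coe_add_of_tendsto ?_
  have hlim : Tendsto (fun t : ℝ => a + b / t) atTop (𝓝 a) := by
    simpa using (tendsto_const_nhds (x := b)).div_atTop tendsto_id |>.const_add a
  refine hlim.congr' ?_
  filter_upwards [eventually_gt_atTop 0] with t ht
  rw [mul_div_cancel_right₀ _ ht.ne']

theorem fAtRatio_add_affine (f : ℝ → ℝ) (a b : ℝ) (r : ℝ≥0∞) :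
    fAtRatio (fun t => f t + (a * t + b)) r = fAtRatio f r + ((a * r.toReal + b : ℝ) : EReal) := by
  rcases eq_or_ne r 0 with rfl | h0
  · simp [fAtRatio, fAtZero_add_affine]
  · simp [fAtRatio, h0]

theorem fSlopeAtTop_nonneg (hf : ∀ t, 0 < t → 0 ≤ f t) : 0 ≤ fSlopeAtTop f :=
  IsAffineMinorant.le_fSlopeAtTop (b := 0) fun t ht => by simpa using hf t ht

theorem fAtRatio_nonneg (hf : ∀ t, 0 < t → 0 ≤ f t) {r : ℝ≥0∞} (hr : r ≠ ∞) :
    0 ≤ fAtRatio f r := by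
  simpa using IsAffineMinorant.le_fAtRatio (a := 0) (b := 0) (fun t ht => by simpa using hf t ht) hr

-- `(x + y)⁺ - (x + y)⁻ = x⁺ + y⁺ - y⁻`, rearranged so that nothing infinite is subtracted.
theorem toENNReal_add_coe_add_ofReal_neg {x : EReal} (hx : 0 ≤ x) (y : ℝ) :
    (x + y).toENNReal + ENNReal.ofReal (-y) =
      x.toENNReal + ENNReal.ofReal y + (-(x + y)).toENNReal := by
  induction x with
  | bot => simp at hx
  | top => simp
  | coe x =>
    have hx : 0 ≤ x := EReal.coe_nonneg.1 hx
    rw [← EReal.coe_add, ← EReal.coe_neg]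
    simp only [EReal.toENNReal_of_ne_top (EReal.coe_ne_top _), EReal.toReal_coe]
    rw [← ENNReal.toReal_eq_toReal_iff' (by finiteness) (by finiteness)]
    repeat rw [ENNReal.toReal_add (by finiteness) (by finiteness)]
    simp only [ENNReal.toReal_ofReal']
    grind

theorem coe_sub_coe_eq_coe_add_of_add_eq {u v w x y : ℝ≥0∞} (hw : w ≠ ∞) (hx : x ≠ ∞)
    (hy : y ≠ ∞) (h : u + y = v + x + w) :
    (u : EReal) - w = v + ((x.toReal - y.toReal : ℝ) : EReal) := by
  lift w to NNReal using hw
  lift x to NNReal using hx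
  lift y to NNReal using hy
  induction v with
  | top =>
    obtain rfl : u = ∞ := by simpa using h
    simp only [EReal.coe_ennreal_top, EReal.coe_nnreal_eq_coe_real, EReal.top_sub_coe,
      EReal.top_add_coe]
  | coe v =>
    have hu : u ≠ ∞ := fun hu => by simp [hu, ← ENNReal.coe_add] at h
    lift u to NNReal using hu
    have h : (u : ℝ) + y = v + x + w := mod_cast h
    simp only [EReal.coe_nnreal_eq_coe_real, ENNReal.coe_toReal, ← EReal.coe_sub, ← EReal.coe_add,
      EReal.coe_eq_coe_iff]
    linarith

variable {O : Type*} [MeasurableSpace O]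

theorem lintegral_toENNReal_add_sub_lintegral_toENNReal_neg {μ : Measure O} {F : O → EReal}
    (hF : Measurable F) (hF0 : ∀ᵐ x ∂μ, 0 ≤ F x) {g : O → ℝ} (hg : Integrable g μ) :
    ((∫⁻ x, (F x + g x).toENNReal ∂μ : ℝ≥0∞) : EReal)
        - (∫⁻ x, (-(F x + g x)).toENNReal ∂μ : ℝ≥0∞)
      = (∫⁻ x, (F x).toENNReal ∂μ : ℝ≥0∞) + ((∫ x, g x ∂μ : ℝ) : EReal) := by
  have hgm : AEMeasurable g μ := hg.aemeasurable
  have hpos : ∫⁻ x, ENNReal.ofReal (g x) ∂μ ≠ ∞ := hg.lintegral_lt_top.ne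
  have hneg : ∫⁻ x, ENNReal.ofReal (-g x) ∂μ ≠ ∞ := hg.neg.lintegral_lt_top.ne
  have hsum : ∫⁻ x, (F x + g x).toENNReal ∂μ + ∫⁻ x, ENNReal.ofReal (-g x) ∂μ =
      ∫⁻ x, (F x).toENNReal ∂μ + ∫⁻ x, ENNReal.ofReal (g x) ∂μ
        + ∫⁻ x, (-(F x + g x)).toENNReal ∂μ := by
    have hgneg : AEMeasurable (fun x => ENNReal.ofReal (-g x)) μ := hgm.neg.ennreal_ofReal
    rw [← lintegral_add_right' _ hgneg, ← lintegral_add_right' _ hgm.ennreal_ofReal,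
      ← lintegral_add_left' (by fun_prop)]
    exact lintegral_congr_ae (hF0.mono fun x hx => toENNReal_add_coe_add_ofReal_neg hx (g x))
  have hneg' : ∫⁻ x, (-(F x + g x)).toENNReal ∂μ ≠ ∞ := by
    refine ((lintegral_mono_ae (hF0.mono fun x hx => ?_)).trans_lt hneg.lt_top).ne
    rw [← EReal.real_coe_toENNReal, EReal.coe_neg]
    exact EReal.toENNReal_le_toENNReal (EReal.neg_le_neg_iff.2 (le_add_of_nonneg_left hx))
  rw [integral_eq_lintegral_pos_part_sub_lintegral_neg_part hg]
  exact coe_sub_coe_eq_coe_add_of_add_eq hneg' hpos hneg hsum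

theorem fDivergence_of_nonneg (hf : ∀ t, 0 < t → 0 ≤ f t) (P Q : Measure O) [SigmaFinite P] :
    fDivergence f P Q = ((∫⁻ x, (fAtRatio f (P.rnDeriv Q x)).toENNReal ∂Q
      + (fSlopeAtTop f).toENNReal * P.singularPart Q Set.univ : ℝ≥0∞) : EReal) := by
  have hneg : ∫⁻ x, (-fAtRatio f (P.rnDeriv Q x)).toENNReal ∂Q = 0 := by
    refine lintegral_eq_zero_of_ae_eq_zero ?_
    filter_upwards [P.rnDeriv_ne_top Q] with x hx
    exact EReal.toENNReal_of_nonpos (by simpa using fAtRatio_nonneg hf hx)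
  rw [fDivergence, hneg, EReal.coe_ennreal_add, EReal.coe_ennreal_mul,
    EReal.coe_toENNReal (fSlopeAtTop_nonneg hf), EReal.coe_ennreal_zero, sub_zero]

theorem fDivergence_add_affine (hfm : Measurable (fAtRatio f)) (hf : ∀ t, 0 < t → 0 ≤ f t)
    (a b : ℝ) (P Q : Measure O) [IsFiniteMeasure P] [IsFiniteMeasure Q] :
    fDivergence (fun t => f t + (a * t + b)) P Q =
      fDivergence f P Q + ((a * P.real Set.univ + b * Q.real Set.univ : ℝ) : EReal) := by
  have hF0 : ∀ᵐ x ∂Q, 0 ≤ fAtRatio f (P.rnDeriv Q x) :=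
    (P.rnDeriv_ne_top Q).mono fun x hx => fAtRatio_nonneg hf hx
  have hr : Integrable (fun x => (P.rnDeriv Q x).toReal) Q := Measure.integrable_toReal_rnDeriv
  have hint : ∫ x, (a * (P.rnDeriv Q x).toReal + b) ∂Q =
      a * (P.real Set.univ - (P.singularPart Q).real Set.univ) + b * Q.real Set.univ := by
    rw [integral_add (hr.const_mul a) (integrable_const b), integral_const_mul, integral_const,
      Measure.integral_toReal_rnDeriv', smul_eq_mul, mul_comm b]
  rw [fDivergence_of_nonneg hf, fDivergence]
  simp only [fAtRatio_add_affine, fSlopeAtTop_add_affine]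
  rw [lintegral_toENNReal_add_sub_lintegral_toENNReal_neg
    (F := fun x => fAtRatio f (P.rnDeriv Q x)) (g := fun x => a * (P.rnDeriv Q x).toReal + b)
    (hfm.comp (Measure.measurable_rnDeriv P Q)) hF0 ((hr.const_mul a).add (integrable_const b)),
    hint, EReal.right_distrib_of_nonneg_of_ne_top (EReal.coe_ennreal_nonneg _) (by simp),
    EReal.coe_ennreal_add, EReal.coe_ennreal_mul, EReal.coe_toENNReal (fSlopeAtTop_nonneg hf),
    ← EReal.coe_ennreal_toReal (measure_ne_top (P.singularPart Q) Set.univ), ← Measure.real,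
    ← EReal.coe_mul, add_add_add_comm, ← EReal.coe_add]
  congr 2
  ring

end Normalization

section Domination

variable {f : ℝ → ℝ} {O : Type*} [MeasurableSpace O] {P Q ν : Measure O}

/-- The measure `ν` dominates `a • P + b • Q` for every affine minorant `t ↦ a * t + b` of `f`. The
coefficients may be negative, so the negative parts stand on the right-hand side. -/
def DominatesAffineMinorants (f : ℝ → ℝ) (P Q ν : Measure O) : Prop :=
  ∀ a b, IsAffineMinorant f a b →
    a.toNNReal • P + b.toNNReal • Q ≤ ν + ((-a).toNNReal • P + (-b).toNNReal • Q)

theorem toNNReal_mul_add_le_iff {p q : ℝ≥0∞} (hp : p ≠ ∞) (hq : q ≠ ∞) (a b : ℝ) (y : ℝ≥0∞) :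
    a.toNNReal * p + b.toNNReal * q ≤ y + ((-a).toNNReal * p + (-b).toNNReal * q) ↔
      ((a * p.toReal + b * q.toReal : ℝ) : EReal) ≤ y := by
  lift p to NNReal using hp
  lift q to NNReal using hq
  induction y with
  | top => simp
  | coe y =>
    rw [EReal.coe_nnreal_eq_coe_real, EReal.coe_le_coe_iff]
    norm_cast
    rw [← NNReal.coe_le_coe]
    push_cast
    simp only [Real.coe_toNNReal', ENNReal.coe_toReal]
    have ha : a = max a 0 - max (-a) 0 := by grind
    have hb : b = max b 0 - max (-b) 0 := by grind
    constructor <;> intro h <;> nlinarith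

theorem rnDeriv_smul_add_smul (P Q : Measure O) [IsFiniteMeasure P] [IsFiniteMeasure Q]
    (c d : NNReal) : (c • P + d • Q).rnDeriv Q =ᵐ[Q] fun x => c * P.rnDeriv Q x + d := by
  filter_upwards [Measure.rnDeriv_add (c • P) (d • Q) Q, P.rnDeriv_smul_left Q c,
    Q.rnDeriv_smul_left Q d, Q.rnDeriv_self] with x hadd hP hQ hself
  rw [hadd, Pi.add_apply, hP, hQ, Pi.smul_apply, Pi.smul_apply, hself, ENNReal.smul_def,
    ENNReal.smul_def, smul_eq_mul, smul_eq_mul, mul_one]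

theorem singularPart_smul_add_smul (P Q : Measure O) [IsFiniteMeasure P] [IsFiniteMeasure Q]
    (c d : NNReal) : (c • P + d • Q).singularPart Q = c • P.singularPart Q := by
  rw [Measure.singularPart_add, Measure.singularPart_smul, Measure.singularPart_smul,
    Measure.singularPart_self, smul_zero, add_zero]

theorem smul_add_smul_eq_singularPart_add_withDensity (P Q : Measure O) [IsFiniteMeasure P]
    [IsFiniteMeasure Q] (c d : NNReal) :
    c • P + d • Q =
      c • P.singularPart Q + Q.withDensity (fun x => c * P.rnDeriv Q x + d) := by
  rw [← singularPart_smul_add_smul P Q c d, ← withDensity_congr_ae (rnDeriv_smul_add_smul P Q c d),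
    Measure.singularPart_add_rnDeriv]

theorem exists_dominatesAffineMinorants_measure_univ (hf : ∀ t, 0 < t → 0 ≤ f t) (P Q : Measure O)
    [IsFiniteMeasure P] [IsFiniteMeasure Q] :
    ∃ ν, DominatesAffineMinorants f P Q ν ∧ (ν Set.univ : EReal) = fDivergence f P Q := by
  let F := fun x => (fAtRatio f (P.rnDeriv Q x)).toENNReal
  refine ⟨(fSlopeAtTop f).toENNReal • P.singularPart Q + Q.withDensity F, fun a b hmin => ?_, ?_⟩
  · have hsing : a.toNNReal • P.singularPart Q ≤
        (fSlopeAtTop f).toENNReal • P.singularPart Q + (-a).toNNReal • P.singularPart Q :=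
      Measure.le_add_right <| Measure.le_intro fun s _ _ =>
        mul_le_mul_left (EReal.toENNReal_le_toENNReal hmin.le_fSlopeAtTop) _
    have hac : Q.withDensity (fun x => a.toNNReal * P.rnDeriv Q x + b.toNNReal) ≤
        Q.withDensity F + Q.withDensity
          (fun x => (-a).toNNReal * P.rnDeriv Q x + (-b).toNNReal) := by
      rw [← withDensity_add_right _ (by fun_prop)]
      refine withDensity_mono ?_
      filter_upwards [P.rnDeriv_ne_top Q] with x hx
      simpa [F] using (toNNReal_mul_add_le_iff hx ENNReal.one_ne_top a b (F x)).2
        (by simpa [F, EReal.coe_toENNReal_eq_max] using Or.inr (hmin.le_fAtRatio hx))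
    rw [smul_add_smul_eq_singularPart_add_withDensity,
      smul_add_smul_eq_singularPart_add_withDensity, add_add_add_comm]
    exact add_le_add hsing hac
  · rw [fDivergence_of_nonneg hf]
    simp [F, add_comm]

theorem rnDeriv_mono_of_le {μ₁ μ₂ : Measure O} [IsFiniteMeasure μ₁] [IsFiniteMeasure μ₂]
    (h : μ₁ ≤ μ₂) (Q : Measure O) [SigmaFinite Q] : μ₁.rnDeriv Q ≤ᵐ[Q] μ₂.rnDeriv Q := by
  filter_upwards [Measure.rnDeriv_add (μ₂ - μ₁) μ₁ Q] with x hx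
  rw [Measure.sub_add_cancel_of_le h] at hx
  exact hx ▸ le_add_self

theorem singularPart_mono_of_le {μ₁ μ₂ : Measure O} [IsFiniteMeasure μ₁] [IsFiniteMeasure μ₂]
    (h : μ₁ ≤ μ₂) (Q : Measure O) [SigmaFinite Q] : μ₁.singularPart Q ≤ μ₂.singularPart Q := by
  rw [← Measure.sub_add_cancel_of_le h, Measure.singularPart_add]
  exact Measure.le_add_left le_rfl

theorem ae_forall_of_isClosed {μ : Measure O} {ι : Type*} [TopologicalSpace ι]
    [TopologicalSpace.SeparableSpace ι] {p : ι → O → Prop}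
    (hclosed : ∀ x, IsClosed {i | p i x}) (h : ∀ i, ∀ᵐ x ∂μ, p i x) : ∀ᵐ x ∂μ, ∀ i, p i x := by
  obtain ⟨D, hD, hdense⟩ := TopologicalSpace.exists_countable_dense ι
  filter_upwards [(ae_ball_iff hD).2 fun i _ => h i] with x hx i
  exact (hclosed x).closure_subset_iff.2 hx (hdense i)

theorem DominatesAffineMinorants.toENNReal_fAtRatio_rnDeriv_le (hf : ConvexOn ℝ (Set.Ioi 0) f)
    [IsFiniteMeasure P] [IsFiniteMeasure Q] [IsFiniteMeasure ν]
    (h : DominatesAffineMinorants f P Q ν) :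
    ∀ᵐ x ∂Q, (fAtRatio f (P.rnDeriv Q x)).toENNReal ≤ ν.rnDeriv Q x := by
  -- Domination gives each minorant almost everywhere; there are uncountably many of them, but the
  -- inequality is closed in the coefficients, so a dense sequence of minorants suffices.
  have hmin (c : {c : ℝ × ℝ // IsAffineMinorant f c.1 c.2}) : ∀ᵐ x ∂Q,
      ((c.1.1 * (P.rnDeriv Q x).toReal + c.1.2 : ℝ) : EReal) ≤ ν.rnDeriv Q x := by
    obtain ⟨⟨a, b⟩, hab⟩ := c
    filter_upwards [rnDeriv_mono_of_le (h a b hab) Q,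
      rnDeriv_smul_add_smul P Q a.toNNReal b.toNNReal,
      Measure.rnDeriv_add ν ((-a).toNNReal • P + (-b).toNNReal • Q) Q,
      rnDeriv_smul_add_smul P Q (-a).toNNReal (-b).toNNReal, P.rnDeriv_ne_top Q]
      with x hle hleft hadd hright hr
    simpa using (toNNReal_mul_add_le_iff hr ENNReal.one_ne_top a b (ν.rnDeriv Q x)).1
      (by simpa [hleft, hadd, hright] using hle)
  have hclosed : ∀ x, IsClosed {c : {c : ℝ × ℝ // IsAffineMinorant f c.1 c.2} |
      ((c.1.1 * (P.rnDeriv Q x).toReal + c.1.2 : ℝ) : EReal) ≤ ν.rnDeriv Q x} := fun x =>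
    isClosed_le (continuous_coe_real_ereal.comp (by fun_prop)) continuous_const
  filter_upwards [ae_forall_of_isClosed hclosed hmin, P.rnDeriv_ne_top Q] with x hx hr
  rw [← EReal.toENNReal_coe (x := ν.rnDeriv Q x)]
  exact EReal.toENNReal_le_toENNReal <| fAtRatio_le_of_forall_isAffineMinorant hf hr
    fun a b hab => hx ⟨(a, b), hab⟩

theorem DominatesAffineMinorants.fSlopeAtTop_mul_le (hf : ConvexOn ℝ (Set.Ioi 0) f)
    [IsFiniteMeasure P] [IsFiniteMeasure Q] [IsFiniteMeasure ν]
    (h : DominatesAffineMinorants f P Q ν) :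
    (fSlopeAtTop f).toENNReal * P.singularPart Q Set.univ ≤ ν.singularPart Q Set.univ := by
  rcases eq_or_ne (P.singularPart Q Set.univ) 0 with h0 | h0
  · simp [h0]
  have htop : P.singularPart Q Set.univ ≠ ∞ := measure_ne_top _ _
  rw [← ENNReal.le_div_iff_mul_le (.inl h0) (.inl htop), ← EReal.coe_ennreal_le_coe_ennreal_iff,
    EReal.coe_toENNReal_eq_max, max_le_iff]
  refine ⟨EReal.coe_ennreal_nonneg _,
    fSlopeAtTop_le_of_forall_isAffineMinorant hf fun a b hab => ?_⟩
  have hle := singularPart_mono_of_le (h a b hab) Q Set.univ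
  rw [Measure.singularPart_add ν, singularPart_smul_add_smul, singularPart_smul_add_smul] at hle
  have hmass : ENNReal.ofReal a * P.singularPart Q Set.univ ≤ ν.singularPart Q Set.univ := by
    rcases le_total 0 a with ha | ha
    · rw [ENNReal.ofReal, ← smul_eq_mul, ← ENNReal.smul_def]
      simpa [Real.toNNReal_of_nonpos (neg_nonpos.2 ha)] using hle
    · simp [ENNReal.ofReal_of_nonpos ha]
  calc
    (a : EReal) ≤ (ENNReal.ofReal a : EReal) := by simp [EReal.coe_ennreal_ofReal]
    _ ≤ _ := EReal.coe_ennreal_le_coe_ennreal_iff.2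
      ((ENNReal.le_div_iff_mul_le (.inl h0) (.inl htop)).2 hmass)

theorem DominatesAffineMinorants.fDivergence_le (hf : ConvexOn ℝ (Set.Ioi 0) f)
    (hf0 : ∀ t, 0 < t → 0 ≤ f t) [IsFiniteMeasure P] [IsFiniteMeasure Q]
    (h : DominatesAffineMinorants f P Q ν) : fDivergence f P Q ≤ ν Set.univ := by
  by_cases hν : ν Set.univ = ∞
  · simp [hν]
  have : IsFiniteMeasure ν := ⟨lt_top_iff_ne_top.2 hν⟩
  rw [fDivergence_of_nonneg hf0, EReal.coe_ennreal_le_coe_ennreal_iff]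
  calc
    _ ≤ ∫⁻ x, ν.rnDeriv Q x ∂Q + ν.singularPart Q Set.univ :=
      add_le_add (lintegral_mono_ae (h.toENNReal_fAtRatio_rnDeriv_le hf)) (h.fSlopeAtTop_mul_le hf)
    _ = ν Set.univ := by
      conv_rhs => rw [← ν.rnDeriv_add_singularPart Q]
      simp

end Domination

section Inequalities

variable {f : ℝ → ℝ} {O O' : Type*} [MeasurableSpace O] [MeasurableSpace O']

theorem measure_comp_mono {μ₁ μ₂ : Measure O} (h : μ₁ ≤ μ₂) (κ : Kernel O O') :
    κ ∘ₘ μ₁ ≤ κ ∘ₘ μ₂ := by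
  refine Measure.le_intro fun s hs _ => ?_
  rw [Measure.bind_apply hs κ.aemeasurable, Measure.bind_apply hs κ.aemeasurable]
  exact lintegral_mono' h le_rfl

theorem measure_smul_mono {μ₁ μ₂ : Measure O} (h : μ₁ ≤ μ₂) (c : NNReal) : c • μ₁ ≤ c • μ₂ :=
  Measure.le_intro fun s _ _ => mul_le_mul_right (h s) (c : ℝ≥0∞)

theorem measure_comp_nnreal_smul (κ : Kernel O O') (c : NNReal) (μ : Measure O) :
    κ ∘ₘ (c • μ) = c • (κ ∘ₘ μ) :=
  Measure.comp_smul (c : ℝ≥0∞)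

theorem DominatesAffineMinorants.comp {P Q ν : Measure O} (h : DominatesAffineMinorants f P Q ν)
    (κ : Kernel O O') : DominatesAffineMinorants f (κ ∘ₘ P) (κ ∘ₘ Q) (κ ∘ₘ ν) := by
  intro a b hab
  simp only [← measure_comp_nnreal_smul, ← Measure.comp_add]
  exact measure_comp_mono (h a b hab) κ

theorem DominatesAffineMinorants.smul_add_smul {P₁ P₂ Q₁ Q₂ ν₁ ν₂ : Measure O}
    (h₁ : DominatesAffineMinorants f P₁ Q₁ ν₁) (h₂ : DominatesAffineMinorants f P₂ Q₂ ν₂)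
    (c d : NNReal) :
    DominatesAffineMinorants f (c • P₁ + d • P₂) (c • Q₁ + d • Q₂) (c • ν₁ + d • ν₂) := by
  intro a b hab
  have hsum := add_le_add (measure_smul_mono (h₁ a b hab) c) (measure_smul_mono (h₂ a b hab) d)
  convert hsum using 1 <;> module

theorem exists_eq_nonneg_add_affine (hf : ConvexOn ℝ (Set.Ioi 0) f) :
    ∃ (h : ℝ → ℝ) (a b : ℝ), ConvexOn ℝ (Set.Ioi 0) h ∧ (∀ t, 0 < t → 0 ≤ h t) ∧
      f = fun t => h t + (a * t + b) := by
  obtain ⟨a, b, hab, -⟩ := exists_isAffineMinorant_eq hf one_pos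
  refine ⟨fun t => f t - (a * t + b), a, b, hf.sub ?_, fun t ht => sub_nonneg.2 (hab t ht), ?_⟩
  · exact ((LinearMap.mulLeft ℝ a).concaveOn (convex_Ioi 0)).add_const b
  · simp

theorem fDivergence_comp_le (hf : ConvexOn ℝ (Set.Ioi 0) f) (P Q : Measure O) [IsFiniteMeasure P]
    [IsFiniteMeasure Q] (κ : Kernel O O') [IsMarkovKernel κ] :
    fDivergence f (κ ∘ₘ P) (κ ∘ₘ Q) ≤ fDivergence f P Q := by
  obtain ⟨h, a, b, hh, hh0, rfl⟩ := exists_eq_nonneg_add_affine hf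
  obtain ⟨ν, hν, hmass⟩ := exists_dominatesAffineMinorants_measure_univ hh0 P Q
  have hle := (hν.comp κ).fDivergence_le hh hh0
  rw [Measure.comp_apply_univ, hmass] at hle
  rw [fDivergence_add_affine (measurable_fAtRatio hh) hh0,
    fDivergence_add_affine (measurable_fAtRatio hh) hh0]
  simp only [Measure.real, Measure.comp_apply_univ]
  gcongr

theorem fDivergence_smul_add_smul_le (hf : ConvexOn ℝ (Set.Ioi 0) f) (P₁ P₂ Q₁ Q₂ : Measure O)
    [IsFiniteMeasure P₁] [IsFiniteMeasure P₂] [IsFiniteMeasure Q₁] [IsFiniteMeasure Q₂]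
    (c d : NNReal) :
    fDivergence f (c • P₁ + d • P₂) (c • Q₁ + d • Q₂) ≤
      ((c : ℝ) : EReal) * fDivergence f P₁ Q₁ + ((d : ℝ) : EReal) * fDivergence f P₂ Q₂ := by
  obtain ⟨h, a, b, hh, hh0, rfl⟩ := exists_eq_nonneg_add_affine hf
  obtain ⟨ν₁, hν₁, hmass₁⟩ := exists_dominatesAffineMinorants_measure_univ hh0 P₁ Q₁
  obtain ⟨ν₂, hν₂, hmass₂⟩ := exists_dominatesAffineMinorants_measure_univ hh0 P₂ Q₂
  have hle : fDivergence h (c • P₁ + d • P₂) (c • Q₁ + d • Q₂) ≤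
      ((c : ℝ) : EReal) * fDivergence h P₁ Q₁ + ((d : ℝ) : EReal) * fDivergence h P₂ Q₂ := by
    refine ((hν₁.smul_add_smul hν₂ c d).fDivergence_le hh hh0).trans_eq ?_
    change ((c * ν₁ Set.univ + d * ν₂ Set.univ : ℝ≥0∞) : EReal) = _
    rw [EReal.coe_ennreal_add, EReal.coe_ennreal_mul, EReal.coe_ennreal_mul, hmass₁, hmass₂]
    rfl
  simp only [fDivergence_add_affine (measurable_fAtRatio hh) hh0]
  rw [EReal.left_distrib_of_nonneg_of_ne_top (EReal.coe_nonneg.2 c.coe_nonneg)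
      (EReal.coe_ne_top _),
    EReal.left_distrib_of_nonneg_of_ne_top (EReal.coe_nonneg.2 d.coe_nonneg) (EReal.coe_ne_top _),
    add_add_add_comm, ← EReal.coe_mul, ← EReal.coe_mul, ← EReal.coe_add]
  refine add_le_add hle (EReal.coe_le_coe_iff.2 (le_of_eq ?_))
  rw [measureReal_add_apply, measureReal_add_apply]
  simp only [measureReal_nnreal_smul_apply]
  ring

theorem fDivergence_smul_add_smul_le_of_le (hf : ConvexOn ℝ (Set.Ioi 0) f)
    {P₁ P₂ Q₁ Q₂ : Measure O} [IsFiniteMeasure P₁] [IsFiniteMeasure P₂] [IsFiniteMeasure Q₁]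
    [IsFiniteMeasure Q₂] {c d : NNReal} (hcd : c + d = 1) {ε : ℝ}
    (h₁ : fDivergence f P₁ Q₁ ≤ ε) (h₂ : fDivergence f P₂ Q₂ ≤ ε) :
    fDivergence f (c • P₁ + d • P₂) (c • Q₁ + d • Q₂) ≤ ε :=
  calc fDivergence f (c • P₁ + d • P₂) (c • Q₁ + d • Q₂)
      ≤ ((c : ℝ) : EReal) * fDivergence f P₁ Q₁ + ((d : ℝ) : EReal) * fDivergence f P₂ Q₂ :=
        fDivergence_smul_add_smul_le hf P₁ P₂ Q₁ Q₂ c d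
    _ ≤ ((c : ℝ) : EReal) * ε + ((d : ℝ) : EReal) * ε :=
        add_le_add (mul_le_mul_of_nonneg_left h₁ (EReal.coe_nonneg.2 c.coe_nonneg))
          (mul_le_mul_of_nonneg_left h₂ (EReal.coe_nonneg.2 d.coe_nonneg))
    _ = ε := by
        rw [← EReal.coe_mul, ← EReal.coe_mul, ← EReal.coe_add, ← add_mul, ← NNReal.coe_add, hcd,
          NNReal.coe_one, one_mul]

end Inequalities

section Mixture

variable {𝒟 O : Type*} [MeasurableSpace 𝒟] [MeasurableSpace O]

theorem mixKernel_apply (p : unitInterval) (M₁ M₂ : Kernel 𝒟 O) (D : 𝒟) :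
    mixKernel p M₁ M₂ D = (p : ℝ).toNNReal • M₁ D + (1 - (p : ℝ)).toNNReal • M₂ D :=
  rfl

theorem toNNReal_add_toNNReal_one_sub (p : unitInterval) :
    (p : ℝ).toNNReal + (1 - (p : ℝ)).toNNReal = 1 := by
  rw [← Real.toNNReal_add p.2.1 (sub_nonneg.2 p.2.2), add_sub_cancel, Real.toNNReal_one]

instance isMarkovKernel_mixKernel (p : unitInterval) (M₁ M₂ : Kernel 𝒟 O) [IsMarkovKernel M₁]
    [IsMarkovKernel M₂] : IsMarkovKernel (mixKernel p M₁ M₂) where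
  isProbabilityMeasure D := ⟨by
    simpa [mixKernel_apply] using mod_cast toNNReal_add_toNNReal_one_sub p⟩

end Mixture

section Superlinear

theorem toENNReal_fAtRatio_of_tendsto {f : ℝ → ℝ}
    (hzero : Tendsto f (𝓝[>] 0) (𝓝 (f 0))) (r : ℝ≥0∞) :
    (fAtRatio f r).toENNReal = ENNReal.ofReal (f r.toReal) := by
  have hf0 : fAtZero f = f 0 := ((continuous_coe_real_ereal.tendsto (f 0)).comp hzero).limsup_eq
  rcases eq_or_ne r 0 with rfl | hr
  · simp [fAtRatio, hf0]
  · simp [fAtRatio, hr]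

theorem fDivergence_of_nonneg_of_tendsto {O : Type*} [MeasurableSpace O] {f : ℝ → ℝ}
    (hf : ∀ t, 0 < t → 0 ≤ f t) (hzero : Tendsto f (𝓝[>] 0) (𝓝 (f 0)))
    (htop : Tendsto (fun t => f t / t) atTop atTop) (P Q : Measure O) [SigmaFinite P] :
    fDivergence f P Q = ((∫⁻ x, ENNReal.ofReal (f (P.rnDeriv Q x).toReal) ∂Q
      + ∞ * P.singularPart Q Set.univ : ℝ≥0∞) : EReal) := by
  have hslope : fSlopeAtTop f = ⊤ := (EReal.tendsto_coe_nhds_top_iff.2 htop).limsup_eq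
  rw [fDivergence_of_nonneg hf, hslope, EReal.toENNReal_top]
  simp only [toENNReal_fAtRatio_of_tendsto hzero]

end Superlinear

section KullbackLeibler

variable {O : Type*} [MeasurableSpace O]

theorem tendsto_klFun_div_atTop : Tendsto (fun t => klFun t / t) atTop atTop := by
  have hlog : Tendsto (fun t : ℝ => Real.log t + (1 / t - 1)) atTop atTop :=
    Real.tendsto_log_atTop.atTop_add ((tendsto_const_nhds.div_atTop tendsto_id).sub_const 1)
  refine hlog.congr' ?_
  filter_upwards [eventually_gt_atTop 0] with t ht
  rw [klFun_apply]
  field_simp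
  ring

theorem fDivergence_klFun (P Q : Measure O) [IsFiniteMeasure P] [IsFiniteMeasure Q] :
    fDivergence klFun P Q = ((klDiv P Q : ℝ≥0∞) : EReal) := by
  rw [fDivergence_of_nonneg_of_tendsto (fun t ht => klFun_nonneg ht.le)
    continuous_klFun.continuousWithinAt tendsto_klFun_div_atTop, klDiv_eq_lintegral_klFun]
  by_cases hac : P ≪ Q
  · simp [hac, Measure.singularPart_eq_zero_of_ac hac]
  · have hsing : P.singularPart Q Set.univ ≠ 0 := by
      rwa [Ne, Measure.measure_univ_eq_zero, Measure.singularPart_eq_zero]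
    simp [hac, ENNReal.top_mul hsing]

end KullbackLeibler

section PrivacyLoss

variable {O : Type*} [MeasurableSpace O]

theorem rnDeriv_add_div_rnDeriv_add_ae_eq_top (P Q : Measure O) [IsFiniteMeasure P]
    [IsFiniteMeasure Q] :
    ∀ᵐ x ∂P.singularPart Q, P.rnDeriv (P + Q) x / Q.rnDeriv (P + Q) x = ∞ := by
  have hle : P.singularPart Q ≪ P := (P.singularPart_le Q).absolutelyContinuous
  have hadd : P ≪ P + Q := Measure.absolutelyContinuous_of_le (Measure.le_add_right le_rfl)
  have hpos : ∀ᵐ x ∂P.singularPart Q, 0 < P.rnDeriv (P + Q) x := hle (Measure.rnDeriv_pos hadd)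
  obtain ⟨N, hN, hQ, hsing⟩ := (P.mutuallySingular_singularPart Q).symm
  have hzero : ∀ᵐ x ∂(P + Q), x ∈ N → Q.rnDeriv (P + Q) x = 0 :=
    (setLIntegral_eq_zero_iff hN (Q.measurable_rnDeriv _)).1
      (le_antisymm ((Measure.setLIntegral_rnDeriv_le N).trans_eq hQ) zero_le)
  filter_upwards [hpos, hle (hadd hzero), measure_eq_zero_iff_ae_notMem.1 hsing]
    with x hx hx0 hxN
  rw [hx0 (not_not.1 hxN), ENNReal.div_zero hx.ne']

theorem exp_mul_privacyLoss (P Q : Measure O) (c : ℝ) (x : O) :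
    EReal.exp ((c : EReal) * privacyLoss P Q x) =
      (P.rnDeriv (P + Q) x / Q.rnDeriv (P + Q) x) ^ c := by
  rw [privacyLoss, ← ENNReal.log_rpow, ENNReal.exp_log]

theorem lintegral_exp_mul_privacyLoss {c : ℝ} (hc : 0 < c) (P Q : Measure O) [IsFiniteMeasure P]
    [IsFiniteMeasure Q] :
    ∫⁻ x, EReal.exp ((c : EReal) * privacyLoss P Q x) ∂P =
      ∫⁻ x, P.rnDeriv Q x ^ (c + 1) ∂Q + ∞ * P.singularPart Q Set.univ := by
  simp only [exp_mul_privacyLoss]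
  have hmeas : Measurable fun x => (P.rnDeriv (P + Q) x / Q.rnDeriv (P + Q) x) ^ c := by fun_prop
  have hsing : ∫⁻ x, (P.rnDeriv (P + Q) x / Q.rnDeriv (P + Q) x) ^ c ∂P.singularPart Q =
      ∞ * P.singularPart Q Set.univ := by
    rw [← lintegral_const]
    refine lintegral_congr_ae ?_
    filter_upwards [rnDeriv_add_div_rnDeriv_add_ae_eq_top P Q] with x hx
    rw [hx, ENNReal.top_rpow_of_pos hc]
  have hac : ∫⁻ x, (P.rnDeriv (P + Q) x / Q.rnDeriv (P + Q) x) ^ c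
      ∂Q.withDensity (P.rnDeriv Q) = ∫⁻ x, P.rnDeriv Q x ^ (c + 1) ∂Q := by
    rw [lintegral_withDensity_eq_lintegral_mul _ (P.measurable_rnDeriv Q) hmeas]
    refine lintegral_congr_ae ?_
    filter_upwards [P.rnDeriv_eq_div_rnDeriv_add Q] with x hx
    rw [Pi.mul_apply, ← hx, ENNReal.rpow_add_of_nonneg _ _ hc.le zero_le_one, ENNReal.rpow_one,
      mul_comm]
  rw [← hac, ← hsing, ← lintegral_add_measure, P.rnDeriv_add_singularPart Q]

theorem fDivergence_rpow {α : ℝ} (hα : 1 < α) (P Q : Measure O) [SigmaFinite P] :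
    fDivergence (fun t => t ^ α) P Q =
      ((∫⁻ x, P.rnDeriv Q x ^ α ∂Q + ∞ * P.singularPart Q Set.univ : ℝ≥0∞) : EReal) := by
  have hα0 : 0 < α := one_pos.trans hα
  have htop : Tendsto (fun t : ℝ => t ^ α / t) atTop atTop := by
    refine (tendsto_rpow_atTop (sub_pos.2 hα)).congr' ?_
    filter_upwards [eventually_gt_atTop 0] with t ht
    rw [Real.rpow_sub_one ht.ne']
  rw [fDivergence_of_nonneg_of_tendsto (fun t ht => Real.rpow_nonneg ht.le α)
    (Real.continuous_rpow_const hα0.le).continuousWithinAt htop]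
  congr 2
  refine lintegral_congr_ae ?_
  filter_upwards [P.rnDeriv_ne_top Q] with x hx
  rw [← ENNReal.ofReal_rpow_of_nonneg ENNReal.toReal_nonneg hα0.le, ENNReal.ofReal_toReal hx]

theorem convexOn_Ioi_rpow {α : ℝ} (hα : 1 ≤ α) : ConvexOn ℝ (Set.Ioi 0) fun t : ℝ => t ^ α :=
  (convexOn_rpow hα).subset Set.Ioi_subset_Ici_self (convex_Ioi 0)

theorem lintegral_exp_privacyLoss_le_iff {α : ℝ} (hα : 1 < α) (P Q : Measure O)
    [IsFiniteMeasure P] [IsFiniteMeasure Q] (c : ℝ) :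
    ∫⁻ x, EReal.exp (((α - 1 : ℝ) : EReal) * privacyLoss P Q x) ∂P
        ≤ ENNReal.ofReal (Real.exp c) ↔
      fDivergence (fun t => t ^ α) P Q ≤ (Real.exp c : EReal) := by
  rw [lintegral_exp_mul_privacyLoss (sub_pos.2 hα), sub_add_cancel, fDivergence_rpow hα,
    ← EReal.coe_ennreal_le_coe_ennreal_iff, EReal.coe_ennreal_ofReal,
    max_eq_left (Real.exp_pos c).le]

end PrivacyLoss

section DivergencePrivacy

variable {𝒟 : Type u} [MeasurableSpace 𝒟] (R : 𝒟 → 𝒟 → Prop)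

theorem satisfiesPrivacyAxioms_divDP {f : ℝ → ℝ} (hf : ConvexOn ℝ (Set.Ioi 0) f) (ε : ℝ) :
    SatisfiesPrivacyAxioms (DivDP.{u, v} R f ε) := by
  refine ⟨fun _ _ _ _ M _ g _ h D₁ D₂ hD => ?_, fun _ _ M₁ M₂ _ _ p h₁ h₂ D₁ D₂ hD => ?_⟩
  · rw [Kernel.comp_apply, Kernel.comp_apply]
    exact (fDivergence_comp_le hf _ _ g).trans (h D₁ D₂ hD)
  · exact fDivergence_smul_add_smul_le_of_le hf (toNNReal_add_toNNReal_one_sub p)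
      (h₁ D₁ D₂ hD) (h₂ D₁ D₂ hD)

theorem SatisfiesPrivacyAxioms.congr {Def Def' : PrivacyDefinition.{u, v} 𝒟}
    (h : SatisfiesPrivacyAxioms Def)
    (hiff : ∀ (O : Type v) [MeasurableSpace O] (M : Kernel 𝒟 O) [IsMarkovKernel M],
      Def O M ↔ Def' O M) : SatisfiesPrivacyAxioms Def' :=
  ⟨fun O O' _ _ M _ g _ hM => (hiff O' _).1 (h.1 O O' M g ((hiff O M).2 hM)),
    fun O _ M₁ M₂ _ _ p h₁ h₂ =>
      (hiff O _).1 (h.2 O M₁ M₂ p ((hiff O M₁).2 h₁) ((hiff O M₂).2 h₂))⟩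

theorem satisfiesPrivacyAxioms_forall {ι : Sort*} {Def : ι → PrivacyDefinition.{u, v} 𝒟}
    (h : ∀ i, SatisfiesPrivacyAxioms (Def i)) :
    SatisfiesPrivacyAxioms fun O _ M => ∀ i, Def i O M :=
  ⟨fun O O' _ _ M _ g _ hM i => (h i).1 O O' M g (hM i),
    fun O _ M₁ M₂ _ _ p h₁ h₂ i => (h i).2 O M₁ M₂ p (h₁ i) (h₂ i)⟩

theorem satisfiesPrivacyAxioms_klPrivacy (ε : ℝ) :
    SatisfiesPrivacyAxioms (KLPrivacy.{u, v} R ε) := by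
  refine (satisfiesPrivacyAxioms_divDP R convexOn_Ioi_klFun ε).congr fun O _ M _ => ?_
  simp only [DivDP, KLPrivacy, fDivergence_klFun]

theorem satisfiesPrivacyAxioms_renyiDP {α : ℝ} (hα : 1 < α) (ε : ℝ) :
    SatisfiesPrivacyAxioms (RenyiDP.{u, v} R α ε) := by
  refine (satisfiesPrivacyAxioms_divDP R (convexOn_Ioi_rpow hα.le)
    (Real.exp ((α - 1) * ε))).congr fun O _ M _ => ?_
  simp only [DivDP, RenyiDP, lintegral_exp_privacyLoss_le_iff hα]

theorem satisfiesPrivacyAxioms_zeroConcentratedDP (ξ ρ : ℝ) :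
    SatisfiesPrivacyAxioms (ZeroConcentratedDP.{u, v} R ξ ρ) := by
  have hall : SatisfiesPrivacyAxioms fun O _ M =>
      ∀ (α : ℝ) (_ : 1 < α), RenyiDP.{u, v} R α (ξ + ρ * α) O M :=
    satisfiesPrivacyAxioms_forall fun α => satisfiesPrivacyAxioms_forall fun hα =>
      satisfiesPrivacyAxioms_renyiDP R hα (ξ + ρ * α)
  refine hall.congr fun O _ M _ => ?_
  simp only [RenyiDP, ZeroConcentratedDP]
  tauto

end DivergencePrivacy

section ApproximatePrivacy

variable {O : Type*} [MeasurableSpace O]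

theorem exists_le_add_of_forall_measure_le_add {P Q : Measure O} [IsFiniteMeasure P]
    [IsFiniteMeasure Q] {δ : ℝ≥0∞} (h : ∀ S, MeasurableSet S → P S ≤ Q S + δ) :
    ∃ ν : Measure O, ν Set.univ ≤ δ ∧ P ≤ ν + Q := by
  obtain ⟨s, hs⟩ := exists_isHahnDecomposition Q P
  have hcancel : P.restrict s - Q.restrict s + Q.restrict s = P.restrict s :=
    Measure.sub_add_cancel_of_le hs.le_on
  refine ⟨P.restrict s - Q.restrict s, ?_, ?_⟩
  · have hmass : (P.restrict s - Q.restrict s) Set.univ + Q s = P s := by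
      simpa using congrArg (fun μ : Measure O => μ Set.univ) hcancel
    rw [← ENNReal.add_le_add_iff_right (measure_ne_top Q s), hmass, add_comm δ]
    exact h s hs.measurableSet
  · calc
      P = P.restrict s + P.restrict sᶜ :=
        (Measure.restrict_add_restrict_compl hs.measurableSet).symm
      _ ≤ P.restrict s + Q.restrict sᶜ := add_le_add_right hs.ge_on_compl _
      _ = P.restrict s - Q.restrict s + Q := by
        rw [← hcancel, add_assoc, Measure.restrict_add_restrict_compl hs.measurableSet, hcancel]

theorem forall_measureReal_le_mul_add_iff (P Q : Measure O) [IsFiniteMeasure P]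
    [IsFiniteMeasure Q] (c : NNReal) (δ : ℝ) :
    (∀ S, MeasurableSet S → P.real S ≤ c * Q.real S + δ) ↔
      0 ≤ δ ∧ ∃ ν : Measure O, ν Set.univ ≤ ENNReal.ofReal δ ∧ P ≤ ν + c • Q := by
  have hreal (hδ : 0 ≤ δ) (S : Set O) :
      P S ≤ (c • Q) S + ENNReal.ofReal δ ↔ P.real S ≤ c * Q.real S + δ := by
    rw [← measureReal_nnreal_smul_apply, measureReal_def, measureReal_def,
      ← ENNReal.toReal_ofReal hδ, ← ENNReal.toReal_add (by finiteness) (by finiteness),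
      ENNReal.toReal_le_toReal (by finiteness) (by finiteness), ENNReal.toReal_ofReal hδ]
  constructor
  · intro h
    have hδ : 0 ≤ δ := by simpa using h ∅ .empty
    exact ⟨hδ, exists_le_add_of_forall_measure_le_add fun S hS => (hreal hδ S).2 (h S hS)⟩
  · rintro ⟨hδ, ν, hmass, hle⟩ S -
    refine (hreal hδ S).1 ((hle S).trans ?_)
    rw [Measure.add_apply, add_comm]
    gcongr
    exact (measure_mono (Set.subset_univ S)).trans hmass

theorem approxDP_iff {𝒟 : Type u} [MeasurableSpace 𝒟] {R : 𝒟 → 𝒟 → Prop} {ε δ : ℝ} {O : Type v}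
    [MeasurableSpace O] {M : Kernel 𝒟 O} [IsMarkovKernel M] :
    ApproxDP R ε δ O M ↔ ∀ D₁ D₂, R D₁ D₂ →
      0 ≤ δ ∧ ∃ ν : Measure O, ν Set.univ ≤ ENNReal.ofReal δ ∧
        M D₁ ≤ ν + (Real.exp ε).toNNReal • M D₂ := by
  simp only [← forall_measureReal_le_mul_add_iff, Real.coe_toNNReal _ (Real.exp_pos ε).le,
    ApproxDP]

theorem satisfiesPrivacyAxioms_approxDP {𝒟 : Type u} [MeasurableSpace 𝒟] (R : 𝒟 → 𝒟 → Prop)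
    (ε δ : ℝ) : SatisfiesPrivacyAxioms (ApproxDP.{u, v} R ε δ) := by
  refine ⟨fun O O' _ _ M _ g _ h => ?_, fun O _ M₁ M₂ _ _ p h₁ h₂ => ?_⟩
  · rw [approxDP_iff] at h ⊢
    intro D₁ D₂ hD
    obtain ⟨hδ, ν, hmass, hle⟩ := h D₁ D₂ hD
    refine ⟨hδ, g ∘ₘ ν, by rwa [Measure.comp_apply_univ], ?_⟩
    rw [Kernel.comp_apply, Kernel.comp_apply, ← measure_comp_nnreal_smul, ← Measure.comp_add]
    exact measure_comp_mono hle g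
  · rw [approxDP_iff] at h₁ h₂ ⊢
    intro D₁ D₂ hD
    obtain ⟨hδ, ν₁, hmass₁, hle₁⟩ := h₁ D₁ D₂ hD
    obtain ⟨-, ν₂, hmass₂, hle₂⟩ := h₂ D₁ D₂ hD
    set c := (p : ℝ).toNNReal
    set d := (1 - (p : ℝ)).toNNReal
    have hcd : c + d = 1 := toNNReal_add_toNNReal_one_sub p
    refine ⟨hδ, c • ν₁ + d • ν₂, ?_, ?_⟩
    · calc
        (c * ν₁ Set.univ + d * ν₂ Set.univ : ℝ≥0∞)
          ≤ c * ENNReal.ofReal δ + d * ENNReal.ofReal δ := by gcongr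
        _ = ENNReal.ofReal δ := by rw [← add_mul, ← ENNReal.coe_add, hcd, ENNReal.coe_one, one_mul]
    · rw [mixKernel_apply, mixKernel_apply]
      convert add_le_add (measure_smul_mono hle₁ c) (measure_smul_mono hle₂ d) using 1
      module

end ApproximatePrivacy

section KernelComposition

variable {X Y Z : Type*} [MeasurableSpace X] [MeasurableSpace Y] [MeasurableSpace Z]

theorem measure_map_compProd (μ : Measure X) [SFinite μ] (κ : Kernel Y Z) [IsSFiniteKernel κ]
    {f : X → Y} (hf : Measurable f) :
    μ.map f ⊗ₘ κ = (μ ⊗ₘ κ.comap f hf).map (Prod.map f id) := by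
  refine Measure.ext_of_lintegral _ fun F hF => ?_
  have hFf : Measurable fun q : X × Z => F (f q.1, q.2) := by fun_prop
  rw [Measure.lintegral_compProd hF, lintegral_map (hF.lintegral_kernel_prod_right') hf,
    lintegral_map hF (by fun_prop)]
  exact (Measure.lintegral_compProd (μ := μ) (κ := κ.comap f hf) hFf).symm

theorem kernel_compProd_prodMkRight (κ : Kernel X Y) [IsSFiniteKernel κ] (η : Kernel X Z)
    [IsSFiniteKernel η] : κ ⊗ₖ η.prodMkRight Y = κ ×ₖ η := by
  ext x s hs
  rw [Kernel.compProd_apply hs, Kernel.prod_apply' _ _ _ hs]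
  rfl

theorem measure_compProd_mixKernel (μ : Measure X) [SFinite μ] (p : unitInterval)
    (κ κ' : Kernel X Y) [IsMarkovKernel κ] [IsMarkovKernel κ'] :
    μ ⊗ₘ mixKernel p κ κ' =
      (p : ℝ).toNNReal • (μ ⊗ₘ κ) + (1 - (p : ℝ)).toNNReal • (μ ⊗ₘ κ') := by
  refine Measure.ext_of_lintegral _ fun F hF => ?_
  have hκ : Measurable fun x => ∫⁻ y, F (x, y) ∂κ x := hF.lintegral_kernel_prod_right'
  have hκ' : Measurable fun x => ∫⁻ y, F (x, y) ∂κ' x := hF.lintegral_kernel_prod_right'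
  simp only [Measure.lintegral_compProd hF, mixKernel_apply, lintegral_add_measure,
    lintegral_smul_measure, ENNReal.smul_def, smul_eq_mul]
  rw [lintegral_add_left (hκ.const_mul _), lintegral_const_mul _ hκ, lintegral_const_mul _ hκ']

theorem mixKernel_comp (p : unitInterval) (κ κ' : Kernel Y Z) (η : Kernel X Y) :
    mixKernel p κ κ' ∘ₖ η = mixKernel p (κ ∘ₖ η) (κ' ∘ₖ η) := by
  refine Kernel.ext fun x => Measure.ext_of_lintegral _ fun F hF => ?_
  simp only [Kernel.lintegral_comp _ _ _ hF, mixKernel_apply, lintegral_add_measure,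
    lintegral_smul_measure, ENNReal.smul_def, smul_eq_mul]
  rw [lintegral_add_left (hF.lintegral_kernel.const_mul _),
    lintegral_const_mul _ hF.lintegral_kernel, lintegral_const_mul _ hF.lintegral_kernel]

theorem klDiv_map_measurableEquiv (e : X ≃ᵐ Y) (μ ν : Measure X) [IsFiniteMeasure μ]
    [IsFiniteMeasure ν] : klDiv (μ.map e) (ν.map e) = klDiv μ ν := by
  refine (klDiv_map_le μ ν e.measurable).antisymm ?_
  simpa using klDiv_map_le (μ.map e) (ν.map e) e.symm.measurable

end KernelComposition

section MutualInformation

variable {T : Type*} {n : ℕ}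

theorem insertRecord_removeNth (i : Fin (n + 1)) (D : Fin (n + 1) → T) :
    insertRecord i (i.removeNth D, D i) = ⟨n + 1, D⟩ :=
  congrArg (Sigma.mk (n + 1)) (Fin.insertNth_self_removeNth i D)

variable [MeasurableSpace T] {O : Type*} [MeasurableSpace O]

theorem measurable_removeNth (i : Fin (n + 1)) :
    Measurable fun D : Fin (n + 1) → T => i.removeNth D :=
  measurable_pi_lambda _ fun j => measurable_pi_apply (i.succAbove j)

/-- The law of `(D_{-i}, D(i))` for `D ∼ θ`. -/
noncomputable def splitLaw (θ : Measure (Fin (n + 1) → T)) (i : Fin (n + 1)) :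
    Measure ((Fin n → T) × T) :=
  θ.map fun D => (i.removeNth D, D i)

theorem measurable_removeNth_prodMk (i : Fin (n + 1)) :
    Measurable fun D : Fin (n + 1) → T => (i.removeNth D, D i) :=
  (measurable_removeNth i).prodMk (measurable_pi_apply i)

instance isProbabilityMeasure_splitLaw (θ : Measure (Fin (n + 1) → T)) [IsProbabilityMeasure θ]
    (i : Fin (n + 1)) : IsProbabilityMeasure (splitLaw θ i) :=
  Measure.isProbabilityMeasure_map (measurable_removeNth_prodMk i).aemeasurable

instance isMarkovKernel_mechOnSize (M : Kernel (Dataset T) O) [IsMarkovKernel M] :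
    IsMarkovKernel (mechOnSize M n) := by
  unfold mechOnSize
  infer_instance

/-- The mechanism `M` as a kernel in `(D_{-i}, D(i))`. -/
noncomputable def outputGivenSplit (M : Kernel (Dataset T) O) (i : Fin (n + 1)) :
    Kernel ((Fin n → T) × T) O :=
  M.comap (insertRecord i) (measurable_insertRecord i)

instance isMarkovKernel_outputGivenSplit (M : Kernel (Dataset T) O) [IsMarkovKernel M]
    (i : Fin (n + 1)) : IsMarkovKernel (outputGivenSplit M i) := by
  unfold outputGivenSplit
  infer_instance

theorem map_compProd_mechOnSize (M : Kernel (Dataset T) O) [IsMarkovKernel M]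
    (θ : Measure (Fin (n + 1) → T)) [IsProbabilityMeasure θ] (i : Fin (n + 1)) :
    (θ ⊗ₘ mechOnSize M (n + 1)).map (fun q => (i.removeNth q.1, q.1 i, q.2)) =
      (splitLaw θ i ⊗ₘ outputGivenSplit M i).map MeasurableEquiv.prodAssoc := by
  have hmech : (outputGivenSplit M i).comap _ (measurable_removeNth_prodMk i) =
      mechOnSize M (n + 1) := Kernel.ext fun D => congrArg M (insertRecord_removeNth i D)
  rw [splitLaw, measure_map_compProd _ _ (measurable_removeNth_prodMk i), hmech,
    Measure.map_map (by fun_prop) ((measurable_removeNth_prodMk i).prodMap measurable_id)]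
  rfl

variable [StandardBorelSpace T] [Nonempty T]

instance isMarkovKernel_recordGivenRest (θ : Measure (Fin (n + 1) → T)) [IsProbabilityMeasure θ]
    (i : Fin (n + 1)) : IsMarkovKernel (recordGivenRest θ i) := by
  unfold recordGivenRest
  infer_instance

instance isMarkovKernel_outputGivenRest (M : Kernel (Dataset T) O) [IsMarkovKernel M]
    (θ : Measure (Fin (n + 1) → T)) [IsProbabilityMeasure θ] (i : Fin (n + 1)) :
    IsMarkovKernel (outputGivenRest M θ i) := by
  unfold outputGivenRest
  infer_instance

variable (M : Kernel (Dataset T) O) (θ : Measure (Fin (n + 1) → T)) [IsProbabilityMeasure θ]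
  (i : Fin (n + 1))

theorem outputGivenRest_comp {O' : Type*} [MeasurableSpace O'] (g : Kernel O O') :
    outputGivenRest (g ∘ₖ M) θ i = g ∘ₖ outputGivenRest M θ i :=
  Kernel.comp_assoc g (outputGivenSplit M i) (Kernel.id ×ₖ recordGivenRest θ i)

theorem outputGivenRest_mixKernel (p : unitInterval) (M' : Kernel (Dataset T) O) :
    outputGivenRest (mixKernel p M M') θ i =
      mixKernel p (outputGivenRest M θ i) (outputGivenRest M' θ i) :=
  mixKernel_comp p (outputGivenSplit M i) (outputGivenSplit M' i)
    (Kernel.id ×ₖ recordGivenRest θ i)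

variable [IsMarkovKernel M]

theorem map_removeNth_compProd_prod :
    θ.map (fun D => i.removeNth D) ⊗ₘ (recordGivenRest θ i ×ₖ outputGivenRest M θ i) =
      (splitLaw θ i ⊗ₘ (outputGivenRest M θ i).prodMkRight T).map MeasurableEquiv.prodAssoc := by
  have hsplit : splitLaw θ i = θ.map (fun D => i.removeNth D) ⊗ₘ recordGivenRest θ i :=
    (compProd_map_condDistrib (measurable_pi_apply i).aemeasurable).symm
  rw [← kernel_compProd_prodMkRight, hsplit, Measure.compProd_assoc']

theorem recordMutualInfo_eq_klDiv_compProd :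
    recordMutualInfo M θ i = klDiv (splitLaw θ i ⊗ₘ outputGivenSplit M i)
      (splitLaw θ i ⊗ₘ (outputGivenRest M θ i).prodMkRight T) := by
  rw [recordMutualInfo, map_compProd_mechOnSize, map_removeNth_compProd_prod,
    klDiv_map_measurableEquiv]

theorem recordMutualInfo_comp_le {O' : Type*} [MeasurableSpace O'] (g : Kernel O O')
    [IsMarkovKernel g] : recordMutualInfo (g ∘ₖ M) θ i ≤ recordMutualInfo M θ i := by
  have hsplit : outputGivenSplit (g ∘ₖ M) i = g ∘ₖ outputGivenSplit M i := rfl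
  have hrest : (outputGivenRest (g ∘ₖ M) θ i).prodMkRight T =
      g ∘ₖ (outputGivenRest M θ i).prodMkRight T := by
    rw [outputGivenRest_comp]
    rfl
  rw [recordMutualInfo_eq_klDiv_compProd, recordMutualInfo_eq_klDiv_compProd, hsplit, hrest,
    ← Measure.parallelComp_comp_compProd, ← Measure.parallelComp_comp_compProd]
  exact klDiv_comp_right_le _ _ _

theorem recordMutualInfo_mixKernel_le (p : unitInterval) (M' : Kernel (Dataset T) O)
    [IsMarkovKernel M'] {ε : ℝ} (h : (recordMutualInfo M θ i : EReal) ≤ ε)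
    (h' : (recordMutualInfo M' θ i : EReal) ≤ ε) :
    (recordMutualInfo (mixKernel p M M') θ i : EReal) ≤ ε := by
  have hsplit : outputGivenSplit (mixKernel p M M') i =
      mixKernel p (outputGivenSplit M i) (outputGivenSplit M' i) := rfl
  have hrest : (outputGivenRest (mixKernel p M M') θ i).prodMkRight T =
      mixKernel p ((outputGivenRest M θ i).prodMkRight T)
        ((outputGivenRest M' θ i).prodMkRight T) := by
    rw [outputGivenRest_mixKernel]
    rfl
  rw [recordMutualInfo_eq_klDiv_compProd, ← fDivergence_klFun] at h h' ⊢
  rw [hsplit, hrest, measure_compProd_mixKernel, measure_compProd_mixKernel]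
  exact fDivergence_smul_add_smul_le_of_le convexOn_Ioi_klFun (toNNReal_add_toNNReal_one_sub p) h h'

end MutualInformation

theorem satisfiesPrivacyAxioms_miPrivacy (T : Type w) [MeasurableSpace T] [StandardBorelSpace T]
    [Nonempty T] (ε : ℝ) : SatisfiesPrivacyAxioms (MIPrivacy.{v, w} T ε) :=
  ⟨fun _ _ _ _ M _ g _ h n θ _ i =>
      (EReal.coe_ennreal_le_coe_ennreal_iff.2 (recordMutualInfo_comp_le M θ i g)).trans (h n θ i),
    fun _ _ M₁ M₂ _ _ p h₁ h₂ n θ _ i =>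
      recordMutualInfo_mixKernel_le M₁ θ i p M₂ (h₁ n θ i) (h₂ n θ i)⟩

theorem mainTheorem1 {𝒟 : Type u} [MeasurableSpace 𝒟] (R : 𝒟 → 𝒟 → Prop)
    (T : Type w) [MeasurableSpace T] [StandardBorelSpace T] [Nonempty T] :
    (∀ f : ℝ → ℝ, ConvexOn ℝ (Set.Ioi 0) f → f 1 = 0 → ∀ ε : ℝ,
      SatisfiesPrivacyAxioms (DivDP.{u, v} R f ε)) ∧
    (∀ ε δ : ℝ, SatisfiesPrivacyAxioms (ApproxDP.{u, v} R ε δ)) ∧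
    (∀ ε : ℝ, SatisfiesPrivacyAxioms (MIPrivacy.{v, w} T ε)) ∧
    (∀ ε : ℝ, SatisfiesPrivacyAxioms (KLPrivacy.{u, v} R ε)) ∧
    (∀ α ε : ℝ, 1 < α → SatisfiesPrivacyAxioms (RenyiDP.{u, v} R α ε)) ∧
    (∀ ξ ρ : ℝ, SatisfiesPrivacyAxioms (ZeroConcentratedDP.{u, v} R ξ ρ)) :=
  ⟨fun _ hf _ ε => satisfiesPrivacyAxioms_divDP R hf ε, satisfiesPrivacyAxioms_approxDP R,
    satisfiesPrivacyAxioms_miPrivacy T, satisfiesPrivacyAxioms_klPrivacy R,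
    fun _ ε hα => satisfiesPrivacyAxioms_renyiDP R hα ε,
    satisfiesPrivacyAxioms_zeroConcentratedDP R⟩
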